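/- Let $n\ge 2$, let $S^n=\{x\in\mathbb R^{n+1}:|x|=1\}$ carry the surface area measure $dx$, and let $\sigma_{n-1}=2\pi^{n/2}/\Gamma(n/2)$. For $\alpha>0$ define the one-sided spherical fractional integrals of a (real- or complex-valued) function $\varphi$ on $S^n$ by $$(S^\alpha_{+}\varphi)(x)=\frac{2}{\Gamma(\alpha)\,\sigma_{n-1}}\int_{\{y\in S^n:\,-1<y_{n+1}<x_{n+1}\}}\frac{(x_{n+1}-y_{n+1})^\alpha}{|x-y|^n}\,\varphi(y)\,dy,$$ $$(S^\alpha_{-}\varphi)(x)=\frac{2}{\Gamma(\alpha)\,\sigma_{n-1}}\int_{\{y\in S^n:\,x_{n+1}<y_{n+1}<1\}}\frac{(y_{n+1}-x_{n+1})^\alpha}{|x-y|^n}\,\varphi(y)\,dy.$$ Theorem. If $\alpha>0$ and $1<p<n/\alpha$, then the operators $S^\alpha_{+}$ and $S^\alpha_{-}$ are bounded from $L^p(S^n)$ to $L^{p_\alpha}(S^n)$, where $p_\alpha=\dfrac{np}{n-\alpha p}$. That is, there is a constant $C$, depending only on $n,\alpha,p$, such that for every $\varphi\in L^p(S^n)$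 the integrals defining $(S^\alpha_{\pm}\varphi)(x)$ converge absolutely for almost every $x\in S^n$, the functions $S^\alpha_{\pm}\varphi$ belong to $L^{p_\alpha}(S^n)$, and $$\|S^\alpha_{\pm}\varphi\|_{L^{p_\alpha}(S^n)}\le C\,\|\varphi\|_{L^p(S^n)}.$$ -/

import Mathlib

open MeasureTheory
open scoped ENNReal NNReal

noncomputable section

namespace SphFrac

/-- The unit sphere `S^n` in `ℝ^(n+1)`. -/
abbrev Sph (n : ℕ) : Type := Metric.sphere (0 : EuclideanSpace ℝ (Fin (n + 1))) 1

/-- The surface area measure on `S^n` (the measure of a set `s` is `n + 1` times the Lebesgue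
measure of the cone over `s` inside the unit ball). -/
def surfaceMeasure (n : ℕ) : Measure (Sph n) :=
  (volume : Measure (EuclideanSpace ℝ (Fin (n + 1)))).toSphere

/-- The last coordinate `x_{n+1}` of a point of `S^n`. -/
def lastCoord {n : ℕ} (x : Sph n) : ℝ :=
  (x : EuclideanSpace ℝ (Fin (n + 1))) (Fin.last n)

/-- The spherical segment `⟨a, b⟩_S`. -/
def segment (n : ℕ) (a b : ℝ) : Set (Sph n) := {y | a < lastCoord y ∧ lastCoord y < b}

/-- The surface area `σ_{n-1} = 2 π^{n/2} / Γ(n/2)` of the unit sphere of `ℝ^n`. -/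
def sigma (n : ℕ) : ℝ := 2 * Real.pi ^ ((n : ℝ) / 2) / Real.Gamma ((n : ℝ) / 2)

variable {𝕜 : Type*} [RCLike 𝕜] {n : ℕ}

/-- The integrand of the left-sided integral at the point `x`. -/
def leftIntegrand (α : ℝ) (φ : Sph n → 𝕜) (x y : Sph n) : 𝕜 :=
  ((lastCoord x - lastCoord y) ^ α / dist x y ^ n) • φ y

/-- The integrand of the right-sided integral at the point `x`. -/
def rightIntegrand (α : ℝ) (φ : Sph n → 𝕜) (x y : Sph n) : 𝕜 :=
  ((lastCoord y - lastCoord x) ^ α / dist x y ^ n) • φ y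

/-- The left-sided spherical fractional integral `S^α_{a+} φ`. -/
def leftInt (α a : ℝ) (φ : Sph n → 𝕜) (x : Sph n) : 𝕜 :=
  (2 / (Real.Gamma α * sigma n)) •
    ∫ y in segment n a (lastCoord x), leftIntegrand α φ x y ∂(surfaceMeasure n)

/-- The right-sided spherical fractional integral `S^α_{b-} φ`. -/
def rightInt (α b : ℝ) (φ : Sph n → 𝕜) (x : Sph n) : 𝕜 :=
  (2 / (Real.Gamma α * sigma n)) •
    ∫ y in segment n (lastCoord x) b, rightIntegrand α φ x y ∂(surfaceMeasure n)

/-- `S^α_+ = S^α_{-1+}`. -/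
def Splus (α : ℝ) (φ : Sph n → 𝕜) : Sph n → 𝕜 := leftInt α (-1) φ

/-- `S^α_- = S^α_{1-}`. -/
def Sminus (α : ℝ) (φ : Sph n → 𝕜) : Sph n → 𝕜 := rightInt α 1 φ

end SphFrac

end

/-!
Since `|x_{n+1} - y_{n+1}| ≤ |x - y|`, both kernels are dominated by `|x - y| ^ (α - n)`, so the
theorem follows from the Hardy–Littlewood–Sobolev inequality on any space whose balls of radius `r`
have measure at most `A * r ^ ν`.

By duality it suffices to bound `∬ g x * dist x y ^ (-β) * f y` for `f` and `g` of norm one in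
`L^p` and `L^r`, where `1 / p + 1 / r + β / ν = 2`. The pairs are split according to whether
`f y ^ p ≤ g x ^ r`. On that half, for fixed `x`, the truncated `f` has norm at most one and
height at most `g x ^ (r / p)`. Hölder's inequality controls its mass in large balls and the
height controls it in small balls, so cutting the layer-cake integral of the potential at the
optimal radius yields a bound by a power of the height; multiplied by `g x`, this power is
`C * g x ^ r`, which is integrable. The other half is symmetric in the two functions.

For the sphere, the growth of balls comes from the cone `V` over the ball of radius `r` about `x`:
it is contained in `(1 - r) • V` together with the ball of radius `2 * r` about `x`, whence
`r * vol V ≤ (2 * r) ^ (n + 1) * vol B`, where `B` is the unit ball.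
-/

namespace SphFrac

section WeakType

variable {Ω : Type*} [MeasurableSpace Ω] {m : Measure Ω}

theorem lintegral_Ioc_zero_rpow {s T : ℝ} (hs : -1 < s) (hT : 0 ≤ T) :
    ∫⁻ t in Set.Ioc 0 T, ENNReal.ofReal (t ^ s) = ENNReal.ofReal (T ^ (s + 1) / (s + 1)) := by
  rw [← ofReal_integral_eq_lintegral_ofReal, ← intervalIntegral.integral_of_le hT,
    integral_rpow (Or.inl hs), Real.zero_rpow (by linarith), sub_zero]
  · exact (intervalIntegrable_iff_integrableOn_Ioc_of_le hT).1
      (intervalIntegral.intervalIntegrable_rpow' hs)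
  · exact (ae_restrict_mem measurableSet_Ioc).mono fun t ht => Real.rpow_nonneg ht.1.le _

theorem lintegral_Ioi_rpow {s T : ℝ} (hs : s < -1) (hT : 0 < T) :
    ∫⁻ t in Set.Ioi T, ENNReal.ofReal (t ^ s) = ENNReal.ofReal (-T ^ (s + 1) / (s + 1)) := by
  rw [← ofReal_integral_eq_lintegral_ofReal, integral_Ioi_rpow_of_lt hs hT]
  · exact integrableOn_Ioi_rpow_of_lt hs hT
  · exact (ae_restrict_mem measurableSet_Ioi).mono
      fun t ht => Real.rpow_nonneg (hT.le.trans (le_of_lt ht)) _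

theorem lintegral_rpow_le_of_measure_lt_le {g : Ω → ℝ} (hg₀ : ∀ y, 0 ≤ g y) (hg : AEMeasurable g m)
    {β r₀ r₁ T : ℝ} (hβ : 0 < β) (hr₀ : r₀ < β) (hr₁ : β < r₁) (hT : 0 < T) {a b : ℝ≥0∞}
    (ha : ∀ t, 0 < t → m {y | t < g y} ≤ a * ENNReal.ofReal (t ^ (-r₀)))
    (hb : ∀ t, 0 < t → m {y | t < g y} ≤ b * ENNReal.ofReal (t ^ (-r₁))) :
    ∫⁻ y, ENNReal.ofReal (g y ^ β) ∂m ≤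
      ENNReal.ofReal β * (a * ENNReal.ofReal (T ^ (β - r₀) / (β - r₀)) +
        b * ENNReal.ofReal (T ^ (β - r₁) / (r₁ - β))) := by
  have weak_mul {c : ℝ≥0∞} {r : ℝ}
      (hc : ∀ t, 0 < t → m {y | t < g y} ≤ c * ENNReal.ofReal (t ^ (-r))) (t : ℝ) (ht : 0 < t) :
      m {y | t < g y} * ENNReal.ofReal (t ^ (β - 1)) ≤ c * ENNReal.ofReal (t ^ (β - r - 1)) := by
    calc m {y | t < g y} * ENNReal.ofReal (t ^ (β - 1))
        ≤ c * ENNReal.ofReal (t ^ (-r)) * ENNReal.ofReal (t ^ (β - 1)) := by gcongr; exact hc t ht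
      _ = c * ENNReal.ofReal (t ^ (β - r - 1)) := by
        rw [mul_assoc, ← ENNReal.ofReal_mul (by positivity), ← Real.rpow_add ht]
        ring_nf
  have low : ∫⁻ t in Set.Ioc 0 T, m {y | t < g y} * ENNReal.ofReal (t ^ (β - 1)) ≤
      a * ENNReal.ofReal (T ^ (β - r₀) / (β - r₀)) := by
    refine (setLIntegral_mono' measurableSet_Ioc fun t ht => weak_mul ha t ht.1).trans_eq ?_
    rw [lintegral_const_mul _ (by fun_prop), lintegral_Ioc_zero_rpow (by linarith) hT.le,
      sub_add_cancel]
  have high : ∫⁻ t in Set.Ioi T, m {y | t < g y} * ENNReal.ofReal (t ^ (β - 1)) ≤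
      b * ENNReal.ofReal (T ^ (β - r₁) / (r₁ - β)) := by
    refine (setLIntegral_mono' measurableSet_Ioi
      fun t ht => weak_mul hb t (hT.trans ht)).trans_eq ?_
    rw [lintegral_const_mul _ (by fun_prop), lintegral_Ioi_rpow (by linarith) hT,
      sub_add_cancel, ← neg_sub r₁ β, neg_div_neg_eq]
  rw [lintegral_rpow_eq_lintegral_meas_lt_mul m (.of_forall hg₀) hg hβ,
    ← Set.Ioc_union_Ioi_eq_Ioi hT.le,
    lintegral_union measurableSet_Ioi (Set.Ioc_disjoint_Ioi le_rfl)]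
  gcongr

theorem eLpNorm_ofReal {E : Type*} [ENorm E] {r : ℝ} (hr : 0 < r) (f : Ω → E) :
    eLpNorm f (ENNReal.ofReal r) m = (∫⁻ x, ‖f x‖ₑ ^ r ∂m) ^ r⁻¹ := by
  rw [eLpNorm_eq_lintegral_rpow_enorm_toReal (by simpa using hr) ENNReal.ofReal_ne_top,
    ENNReal.toReal_ofReal hr.le, one_div]

theorem setLIntegral_le_measure_rpow_mul {p : ℝ} (hp : 1 < p) {f : Ω → ℝ≥0∞} (hf : Measurable f)
    (s : Set Ω) :
    ∫⁻ y in s, f y ∂m ≤ m s ^ (1 - p⁻¹) * (∫⁻ y, f y ^ p ∂m) ^ p⁻¹ := by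
  have hpq := Real.HolderConjugate.conjExponent hp
  calc ∫⁻ y in s, f y ∂m
      ≤ (∫⁻ y in s, f y ^ p ∂m) ^ p⁻¹ * m s ^ (1 - p⁻¹) := by
        simpa [hpq.one_sub_inv] using ENNReal.lintegral_mul_le_Lp_mul_Lq (m.restrict s) hpq
          hf.aemeasurable (aemeasurable_const (b := 1))
    _ ≤ (∫⁻ y, f y ^ p ∂m) ^ p⁻¹ * m s ^ (1 - p⁻¹) :=
        mul_le_mul_left (ENNReal.rpow_le_rpow (setLIntegral_le_lintegral _ _) hpq.inv_nonneg) _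
    _ = m s ^ (1 - p⁻¹) * (∫⁻ y, f y ^ p ∂m) ^ p⁻¹ := mul_comm _ _

theorem exists_simpleFunc_le_lt_lintegral [SigmaFinite m] {f : Ω → ℝ≥0∞} {L : ℝ≥0∞}
    (hL : L < ∫⁻ y, f y ∂m) :
    ∃ g : SimpleFunc Ω ℝ≥0, (∀ y, g y ≤ f y) ∧ ∫⁻ y, g y ∂m < ∞ ∧ L < ∫⁻ y, g y ∂m := by
  rw [lintegral_eq_nnreal] at hL
  simp only [lt_iSup_iff] at hL
  obtain ⟨ψ, hψf, hLψ⟩ := hL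
  rw [← SimpleFunc.lintegral_eq_lintegral] at hLψ
  obtain ⟨g, hgψ, hg, hLg⟩ := SimpleFunc.exists_lt_lintegral_simpleFunc_of_lt_lintegral hLψ
  exact ⟨g, fun y => (ENNReal.coe_le_coe.2 (hgψ y)).trans (hψf y), hg, hLg⟩

theorem lintegral_rpow_le_of_forall_lintegral_mul_le [SigmaFinite m] {q r : ℝ}
    (hqr : q.HolderConjugate r) {h : Ω → ℝ≥0∞} {C : ℝ≥0∞}
    (hC : ∀ g, Measurable g → ∫⁻ y, g y ^ r ∂m ≤ 1 → ∫⁻ y, g y * h y ∂m ≤ C) :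
    ∫⁻ y, h y ^ q ∂m ≤ C ^ q := by
  refine le_of_forall_lt fun L hL => ?_
  obtain ⟨g, hgh, hgfin, hLg⟩ := exists_simpleFunc_le_lt_lintegral hL
  refine hLg.trans_le ?_
  set N := ∫⁻ y, g y ∂m
  have hN : N ≠ 0 := (zero_le.trans_lt hLg).ne'
  have test_norm : ∫⁻ y, ((g y / N : ℝ≥0∞) ^ r⁻¹) ^ r ∂m ≤ 1 := by
    simp_rw [ENNReal.rpow_inv_rpow hqr.symm.ne_zero, div_eq_mul_inv]
    rw [lintegral_mul_const _ (by fun_prop), ENNReal.mul_inv_cancel hN hgfin.ne]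
  have root_le (y : Ω) : (g y : ℝ≥0∞) ^ q⁻¹ ≤ h y :=
    (ENNReal.rpow_inv_le_iff hqr.pos).2 (hgh y)
  have pairing (y : Ω) : g y / N ^ r⁻¹ ≤ (g y / N : ℝ≥0∞) ^ r⁻¹ * h y := by
    calc (g y : ℝ≥0∞) / N ^ r⁻¹ = (g y) ^ (r⁻¹ + q⁻¹) / N ^ r⁻¹ := by
          rw [hqr.symm.inv_add_inv_eq_one, ENNReal.rpow_one]
      _ = (g y / N : ℝ≥0∞) ^ r⁻¹ * g y ^ q⁻¹ := by
          rw [ENNReal.rpow_add_of_nonneg _ _ hqr.symm.inv_nonneg hqr.inv_nonneg,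
            ENNReal.div_rpow_of_nonneg _ _ hqr.symm.inv_nonneg, ENNReal.mul_div_right_comm]
      _ ≤ (g y / N : ℝ≥0∞) ^ r⁻¹ * h y := by gcongr; exact root_le y
  rw [← ENNReal.rpow_inv_le_iff hqr.pos]
  calc N ^ q⁻¹ = N / N ^ r⁻¹ := by
        rw [← hqr.symm.one_sub_inv, ENNReal.rpow_sub _ _ hN hgfin.ne, ENNReal.rpow_one]
    _ = ∫⁻ y, g y / N ^ r⁻¹ ∂m := by
        simp_rw [div_eq_mul_inv]
        rw [lintegral_mul_const _ (by fun_prop)]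
    _ ≤ ∫⁻ y, (g y / N : ℝ≥0∞) ^ r⁻¹ * h y ∂m := lintegral_mono pairing
    _ ≤ C := hC _ (by fun_prop) test_norm

end WeakType

section RieszPotential

variable {X : Type*} [PseudoMetricSpace X]

/-- The integrand `g x * dist x y ^ (-β) * f y` of the bilinear form of the Riesz potential,
restricted to the pairs `(x, y)` with `f y ^ p ≤ g x ^ r`, that is, to the pairs where `g` is the
larger of the two functions at their respective scales. -/
noncomputable def dominatedIntegrand (β p r : ℝ) (f g : X → ℝ≥0∞) (x y : X) : ℝ≥0∞ :=
  g x * (ENNReal.ofReal (dist x y ^ (-β)) * {z | f z ^ p ≤ g x ^ r}.indicator f y)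

theorem mul_kernel_mul_le_dominatedIntegrand_add (β p r : ℝ) (f g : X → ℝ≥0∞) (x y : X) :
    g x * (ENNReal.ofReal (dist x y ^ (-β)) * f y) ≤
      dominatedIntegrand β p r f g x y + dominatedIntegrand β r p g f y x := by
  rcases le_total (f y ^ p) (g x ^ r) with h | h
  · simp [dominatedIntegrand, h]
  · refine le_add_left (le_of_eq ?_)
    rw [dominatedIntegrand, dist_comm y x,
      Set.indicator_of_mem (show x ∈ {z | g z ^ r ≤ f y ^ p} from h)]
    ring

variable [MeasurableSpace X] {μ : Measure X}

/-- Upper Ahlfors regularity: balls of radius `r` have measure at most `A * r ^ ν`. -/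
def IsUpperRegular (μ : Measure X) (A : ℝ≥0) (ν : ℝ) : Prop :=
  ∀ x r, 0 < r → μ (Metric.ball x r) ≤ A * ENNReal.ofReal (r ^ ν)

theorem IsUpperRegular.measure_ball_inv_le {A : ℝ≥0} {ν : ℝ} (hμ : IsUpperRegular μ A ν) (x : X)
    {t : ℝ} (ht : 0 < t) : μ (Metric.ball x t⁻¹) ≤ A * ENNReal.ofReal (t ^ (-ν)) := by
  simpa [Real.inv_rpow ht.le, Real.rpow_neg ht.le] using hμ x t⁻¹ (inv_pos.2 ht)

/-- The Riesz potential `∫ dist x y ^ (-β) f y dμ y` of a nonnegative function, of order `ν - β` on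
a space of dimension `ν`. For `0 < β` the kernel vanishes at distance `0`, since `0 ^ (-β) = 0`. -/
noncomputable def rieszPotential (μ : Measure X) (β : ℝ) (f : X → ℝ≥0∞) (x : X) : ℝ≥0∞ :=
  ∫⁻ y, ENNReal.ofReal (dist x y ^ (-β)) * f y ∂μ

theorem rieszPotential_congr_ae {f g : X → ℝ≥0∞} (hfg : f =ᵐ[μ] g) (β : ℝ) :
    rieszPotential μ β f = rieszPotential μ β g :=
  funext fun _ => lintegral_congr_ae (hfg.mono fun y hy => by simp only [hy])

variable [OpensMeasurableSpace X]

theorem rieszPotential_eq_lintegral_withDensity {f : X → ℝ≥0∞} (hf : Measurable f) (β : ℝ)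
    (x : X) :
    rieszPotential μ β f x = ∫⁻ y, ENNReal.ofReal ((dist x y)⁻¹ ^ β) ∂μ.withDensity f := by
  rw [lintegral_withDensity_eq_lintegral_mul _ hf (by fun_prop)]
  refine lintegral_congr fun y => ?_
  rw [Pi.mul_apply, Real.rpow_neg dist_nonneg, Real.inv_rpow dist_nonneg, mul_comm]

theorem rieszPotential_const_mul {f : X → ℝ≥0∞} (hf : Measurable f) (c : ℝ≥0∞) (β : ℝ) (x : X) :
    rieszPotential μ β (fun y => c * f y) x = c * rieszPotential μ β f x := by
  simp_rw [rieszPotential, mul_left_comm _ c]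
  exact lintegral_const_mul _ (by fun_prop)

theorem withDensity_lt_inv_dist_le (f : X → ℝ≥0∞) (x : X) {t : ℝ} (ht : 0 < t) :
    μ.withDensity f {y | t < (dist x y)⁻¹} ≤ ∫⁻ y in Metric.ball x t⁻¹, f y ∂μ := by
  rw [← withDensity_apply _ Metric.isOpen_ball.measurableSet]
  refine measure_mono fun y hy => ?_
  have hxy : 0 < dist x y := inv_pos.1 (ht.trans hy)
  exact Metric.mem_ball'.2 ((lt_inv_comm₀ ht hxy).1 hy)

theorem measurable_rieszPotential [SecondCountableTopology X] [SFinite μ] {f : X → ℝ≥0∞}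
    (hf : AEMeasurable f μ) (β : ℝ) : Measurable (rieszPotential μ β f) := by
  have := hf.measurable_mk
  rw [rieszPotential_congr_ae hf.ae_eq_mk]
  exact Measurable.lintegral_prod_right'
    (f := fun z : X × X => ENNReal.ofReal (dist z.1 z.2 ^ (-β)) * hf.mk f z.2) (by fun_prop)

theorem IsUpperRegular.withDensity_lt_inv_dist_le_of_lintegral_rpow_le {A : ℝ≥0} {ν p : ℝ}
    (hμ : IsUpperRegular μ A ν) (hp : 1 < p) {f : X → ℝ≥0∞} (hf : Measurable f)
    (hfp : ∫⁻ y, f y ^ p ∂μ ≤ 1) (x : X) {t : ℝ} (ht : 0 < t) :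
    μ.withDensity f {y | t < (dist x y)⁻¹} ≤
      (A : ℝ≥0∞) ^ (1 - p⁻¹) * ENNReal.ofReal (t ^ (-(ν * (1 - p⁻¹)))) := by
  have hp' : 0 ≤ 1 - p⁻¹ := sub_nonneg.2 (inv_le_one_of_one_le₀ hp.le)
  calc μ.withDensity f {y | t < (dist x y)⁻¹}
      ≤ ∫⁻ y in Metric.ball x t⁻¹, f y ∂μ := withDensity_lt_inv_dist_le f x ht
    _ ≤ μ (Metric.ball x t⁻¹) ^ (1 - p⁻¹) * (∫⁻ y, f y ^ p ∂μ) ^ p⁻¹ :=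
      setLIntegral_le_measure_rpow_mul hp hf _
    _ ≤ (A * ENNReal.ofReal (t ^ (-ν))) ^ (1 - p⁻¹) * 1 ^ p⁻¹ := by
      gcongr
      exact hμ.measure_ball_inv_le x ht
    _ = (A : ℝ≥0∞) ^ (1 - p⁻¹) * ENNReal.ofReal (t ^ (-(ν * (1 - p⁻¹)))) := by
      rw [ENNReal.one_rpow, mul_one, ENNReal.mul_rpow_of_nonneg _ _ hp',
        ENNReal.ofReal_rpow_of_nonneg (by positivity) hp', ← Real.rpow_mul ht.le, neg_mul]

theorem IsUpperRegular.withDensity_lt_inv_dist_le_of_le {A : ℝ≥0} {ν : ℝ}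
    (hμ : IsUpperRegular μ A ν) {f : X → ℝ≥0∞} {c : ℝ≥0∞} (hfc : ∀ y, f y ≤ c) (x : X)
    {t : ℝ} (ht : 0 < t) :
    μ.withDensity f {y | t < (dist x y)⁻¹} ≤ c * A * ENNReal.ofReal (t ^ (-ν)) := by
  calc μ.withDensity f {y | t < (dist x y)⁻¹}
      ≤ ∫⁻ y in Metric.ball x t⁻¹, f y ∂μ := withDensity_lt_inv_dist_le f x ht
    _ ≤ ∫⁻ _ in Metric.ball x t⁻¹, c ∂μ := lintegral_mono hfc
    _ ≤ c * A * ENNReal.ofReal (t ^ (-ν)) := by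
      rw [setLIntegral_const, mul_assoc]
      gcongr
      exact hμ.measure_ball_inv_le x ht

theorem exists_rieszPotential_le_of_le {A : ℝ≥0} {ν β p : ℝ} (hμ : IsUpperRegular μ A ν)
    (hp : 1 < p) (hβ : 0 < β) (hβν : β < ν) (hβp : ν * (1 - p⁻¹) < β) :
    ∃ C : ℝ≥0, ∀ f, Measurable f → ∫⁻ y, f y ^ p ∂μ ≤ 1 → ∀ s, 0 < s →
      (∀ y, f y ≤ ENNReal.ofReal s) → ∀ x,
        rieszPotential μ β f x ≤ C * ENNReal.ofReal (s ^ (1 - p + β * p / ν)) := by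
  have hν : 0 < ν := hβ.trans hβν
  have hp' : 0 ≤ 1 - p⁻¹ := sub_nonneg.2 (inv_le_one_of_one_le₀ hp.le)
  refine ⟨β.toNNReal * (A ^ (1 - p⁻¹) * (β - ν * (1 - p⁻¹))⁻¹.toNNReal +
    A * (ν - β)⁻¹.toNNReal), fun f hf hfp s hs hfs x => ?_⟩
  rw [rieszPotential_eq_lintegral_withDensity hf]
  refine (lintegral_rpow_le_of_measure_lt_le (T := s ^ (p / ν)) (fun y => by positivity)
    (by fun_prop) hβ hβp hβν (by positivity)
    (fun t => hμ.withDensity_lt_inv_dist_le_of_lintegral_rpow_le hp hf hfp x)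
    (fun t => hμ.withDensity_lt_inv_dist_le_of_le hfs x)).trans_eq ?_
  have low_power : (s ^ (p / ν)) ^ (β - ν * (1 - p⁻¹)) = s ^ (1 - p + β * p / ν) := by
    rw [← Real.rpow_mul hs.le]
    congr 1; field_simp; ring
  have high_power : s * (s ^ (p / ν)) ^ (β - ν) = s ^ (1 - p + β * p / ν) := by
    nth_rw 1 [← Real.rpow_one s]
    rw [← Real.rpow_mul hs.le, ← Real.rpow_add hs]
    congr 1; field_simp; ring
  rw [low_power, mul_comm (ENNReal.ofReal s), mul_assoc, ← ENNReal.ofReal_mul hs.le,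
    ← mul_div_assoc, high_power, div_eq_mul_inv (s ^ _), div_eq_mul_inv (s ^ _),
    ENNReal.ofReal_mul (by positivity), ENNReal.ofReal_mul (by positivity)]
  push_cast [ENNReal.coe_rpow_of_nonneg _ hp']
  simp only [ENNReal.ofReal]
  ring

theorem lintegral_dominatedIntegrand {f : X → ℝ≥0∞} (hf : Measurable f) (g : X → ℝ≥0∞)
    (β p r : ℝ) (x : X) :
    ∫⁻ y, dominatedIntegrand β p r f g x y ∂μ =
      g x * rieszPotential μ β ({y | f y ^ p ≤ g x ^ r}.indicator f) x := by
  have := hf.indicator (measurableSet_le (hf.pow_const p) (measurable_const (a := g x ^ r)))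
  exact lintegral_const_mul _ (by fun_prop)

theorem measurable_dominatedIntegrand [SecondCountableTopology X] {f g : X → ℝ≥0∞}
    (hf : Measurable f) (hg : Measurable g) (β p r : ℝ) :
    Measurable (Function.uncurry (dominatedIntegrand β p r f g)) := by
  have : Measurable fun z : X × X => {y | f y ^ p ≤ g z.1 ^ r}.indicator f z.2 :=
    Measurable.indicator (f := fun z : X × X => f z.2) (by fun_prop)
      (measurableSet_le (by fun_prop) (by fun_prop))
  unfold dominatedIntegrand Function.uncurry
  fun_prop

theorem exists_mul_rieszPotential_indicator_le {A : ℝ≥0} {ν β p r : ℝ}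
    (hμ : IsUpperRegular μ A ν) (hβ : 0 < β) (hβν : β < ν) (hp : 1 < p) (hr : 1 < r)
    (hpr : p⁻¹ + r⁻¹ + β / ν = 2) :
    ∃ C : ℝ≥0, ∀ f, Measurable f → ∫⁻ y, f y ^ p ∂μ ≤ 1 → ∀ c : ℝ≥0∞, c ≠ ∞ → ∀ x,
      c * rieszPotential μ β ({y | f y ^ p ≤ c ^ r}.indicator f) x ≤ C * c ^ r := by
  have hν : 0 < ν := hβ.trans hβν
  have hp₀ : 0 < p := one_pos.trans hp
  have hβp : ν * (1 - p⁻¹) < β := by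
    rw [← lt_div_iff₀' hν]
    linarith [inv_lt_one_of_one_lt₀ hr]
  obtain ⟨C, hC⟩ := exists_rieszPotential_le_of_le hμ hp hβ hβν hβp
  refine ⟨C, fun f hf hfp c hc x => ?_⟩
  obtain rfl | hc₀ := eq_or_ne c 0
  · simp
  obtain ⟨t, ht, rfl⟩ : ∃ t, 0 < t ∧ c = ENNReal.ofReal t :=
    ⟨_, ENNReal.toReal_pos hc₀ hc, (ENNReal.ofReal_toReal hc).symm⟩
  set h := {y | f y ^ p ≤ ENNReal.ofReal t ^ r}.indicator f
  have hh : Measurable h := hf.indicator (measurableSet_le (by fun_prop) measurable_const)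
  have height (y : X) : h y ≤ ENNReal.ofReal (t ^ (r / p)) := by
    refine Set.indicator_apply_le' (fun hy => ?_) fun _ => zero_le
    rw [← ENNReal.rpow_le_rpow_iff hp₀, ENNReal.ofReal_rpow_of_pos (by positivity),
      ← Real.rpow_mul ht.le, div_mul_cancel₀ _ hp₀.ne', ← ENNReal.ofReal_rpow_of_pos ht]
    exact hy
  have norm_le : ∫⁻ y, h y ^ p ∂μ ≤ 1 :=
    (lintegral_mono fun y => by gcongr; exact Set.indicator_le_self _ f y).trans hfp
  have exponent : t * (t ^ (r / p)) ^ (1 - p + β * p / ν) = t ^ r := by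
    nth_rw 1 [← Real.rpow_one t]
    rw [← Real.rpow_mul ht.le, ← Real.rpow_add ht]
    congr 1
    field_simp at hpr ⊢
    linear_combination hpr
  calc ENNReal.ofReal t * rieszPotential μ β h x
      ≤ ENNReal.ofReal t * (C * ENNReal.ofReal ((t ^ (r / p)) ^ (1 - p + β * p / ν))) := by
        gcongr
        exact hC h hh norm_le _ (by positivity) height x
    _ = C * ENNReal.ofReal t ^ r := by
        rw [mul_left_comm, ← ENNReal.ofReal_mul ht.le, exponent, ENNReal.ofReal_rpow_of_pos ht]

theorem exists_lintegral_dominatedIntegrand_le {A : ℝ≥0} {ν β p r : ℝ}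
    (hμ : IsUpperRegular μ A ν) (hβ : 0 < β) (hβν : β < ν) (hp : 1 < p) (hr : 1 < r)
    (hpr : p⁻¹ + r⁻¹ + β / ν = 2) :
    ∃ C : ℝ≥0, ∀ f g, Measurable f → Measurable g →
      ∫⁻ y, f y ^ p ∂μ ≤ 1 → ∫⁻ y, g y ^ r ∂μ ≤ 1 →
        ∫⁻ x, ∫⁻ y, dominatedIntegrand β p r f g x y ∂μ ∂μ ≤ C := by
  obtain ⟨C, hC⟩ := exists_mul_rieszPotential_indicator_le hμ hβ hβν hp hr hpr
  refine ⟨C, fun f g hf hg hfp hgr => ?_⟩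
  have g_ne_top : ∀ᵐ x ∂μ, g x ≠ ∞ :=
    (ae_lt_top (by fun_prop) (hgr.trans_lt ENNReal.one_lt_top).ne).mono fun x hx =>
      ((ENNReal.rpow_lt_top_iff_of_pos (one_pos.trans hr)).1 hx).ne
  simp_rw [lintegral_dominatedIntegrand hf]
  calc ∫⁻ x, g x * rieszPotential μ β ({y | f y ^ p ≤ g x ^ r}.indicator f) x ∂μ
      ≤ ∫⁻ x, C * g x ^ r ∂μ :=
        lintegral_mono_ae (g_ne_top.mono fun x hx => hC f hf hfp (g x) hx x)
    _ = C * ∫⁻ x, g x ^ r ∂μ := lintegral_const_mul _ (by fun_prop)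
    _ ≤ C := mul_le_of_le_one_right' hgr

theorem exists_lintegral_mul_rieszPotential_le [SecondCountableTopology X] [SFinite μ] {A : ℝ≥0}
    {ν β p r : ℝ} (hμ : IsUpperRegular μ A ν) (hβ : 0 < β) (hβν : β < ν) (hp : 1 < p) (hr : 1 < r)
    (hpr : p⁻¹ + r⁻¹ + β / ν = 2) :
    ∃ C : ℝ≥0, ∀ f g, Measurable f → Measurable g →
      ∫⁻ y, f y ^ p ∂μ ≤ 1 → ∫⁻ y, g y ^ r ∂μ ≤ 1 →
        ∫⁻ x, g x * rieszPotential μ β f x ∂μ ≤ C := by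
  obtain ⟨C₁, hC₁⟩ := exists_lintegral_dominatedIntegrand_le hμ hβ hβν hp hr hpr
  obtain ⟨C₂, hC₂⟩ := exists_lintegral_dominatedIntegrand_le hμ hβ hβν hr hp
    (by rwa [add_comm r⁻¹])
  refine ⟨C₁ + C₂, fun f g hf hg hfp hgr => ?_⟩
  have hfg := measurable_dominatedIntegrand hf hg β p r
  have hgf := measurable_dominatedIntegrand hg hf β r p
  calc ∫⁻ x, g x * rieszPotential μ β f x ∂μ
      = ∫⁻ x, ∫⁻ y, g x * (ENNReal.ofReal (dist x y ^ (-β)) * f y) ∂μ ∂μ :=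
        lintegral_congr fun x => (lintegral_const_mul _ (by fun_prop)).symm
    _ ≤ ∫⁻ x, ∫⁻ y,
          (dominatedIntegrand β p r f g x y + dominatedIntegrand β r p g f y x) ∂μ ∂μ := by
        gcongr
        exact mul_kernel_mul_le_dominatedIntegrand_add β p r f g _ _
    _ = ∫⁻ x, ∫⁻ y, dominatedIntegrand β p r f g x y ∂μ ∂μ +
          ∫⁻ x, ∫⁻ y, dominatedIntegrand β r p g f y x ∂μ ∂μ := by
        rw [← lintegral_add_left hfg.lintegral_prod_right]
        exact lintegral_congr fun x => lintegral_add_left hfg.of_uncurry_left _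
    _ = ∫⁻ x, ∫⁻ y, dominatedIntegrand β p r f g x y ∂μ ∂μ +
          ∫⁻ y, ∫⁻ x, dominatedIntegrand β r p g f y x ∂μ ∂μ := by
        rw [lintegral_lintegral_swap (f := fun x y => dominatedIntegrand β r p g f y x)]
        exact (hgf.comp measurable_swap).aemeasurable
    _ ≤ ↑(C₁ + C₂) := by
        rw [ENNReal.coe_add]
        exact add_le_add (hC₁ f g hf hg hfp hgr) (hC₂ g f hg hf hgr hfp)

theorem exists_lintegral_rieszPotential_rpow_le [SecondCountableTopology X] [SigmaFinite μ]
    {A : ℝ≥0} {ν β p q : ℝ} (hμ : IsUpperRegular μ A ν) (hβ : 0 < β) (hβν : β < ν) (hp : 1 < p)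
    (hq : 0 < q) (hpq : q⁻¹ = p⁻¹ + β / ν - 1) :
    ∃ C : ℝ≥0, ∀ f, Measurable f → ∫⁻ y, f y ^ p ∂μ ≤ 1 →
      ∫⁻ x, rieszPotential μ β f x ^ q ∂μ ≤ (C : ℝ≥0∞) ^ q := by
  have hq₁ : 1 < q := by
    rw [← inv_lt_one₀ hq, hpq]
    linarith [inv_lt_one_of_one_lt₀ hp, (div_lt_one (hβ.trans hβν)).2 hβν]
  have hqr := Real.HolderConjugate.conjExponent hq₁
  obtain ⟨C, hC⟩ := exists_lintegral_mul_rieszPotential_le hμ hβ hβν hp hqr.symm.lt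
    (by linarith [hqr.inv_add_inv_eq_one])
  exact ⟨C, fun f hf hfp => lintegral_rpow_le_of_forall_lintegral_mul_le hqr
    fun g hg hgr => hC f g hf hg hfp hgr⟩

theorem exists_eLpNorm_rieszPotential_le [SecondCountableTopology X] [SigmaFinite μ]
    {A : ℝ≥0} {ν β p q : ℝ} (hμ : IsUpperRegular μ A ν) (hβ : 0 < β) (hβν : β < ν) (hp : 1 < p)
    (hq : 0 < q) (hpq : q⁻¹ = p⁻¹ + β / ν - 1) :
    ∃ C : ℝ≥0, ∀ f, MemLp f (ENNReal.ofReal p) μ →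
      eLpNorm (rieszPotential μ β f) (ENNReal.ofReal q) μ ≤
        C * eLpNorm f (ENNReal.ofReal p) μ := by
  have hp₀ : 0 < p := one_pos.trans hp
  obtain ⟨C, hC⟩ := exists_lintegral_rieszPotential_rpow_le hμ hβ hβν hp hq hpq
  refine ⟨C, fun f hf => ?_⟩
  obtain ⟨g, hg, hfg⟩ := hf.1.aemeasurable
  rw [rieszPotential_congr_ae hfg, eLpNorm_congr_ae hfg]
  set N := eLpNorm g (ENNReal.ofReal p) μ with hN_def
  have hN_top : N ≠ ∞ := (eLpNorm_congr_ae hfg).symm.trans_ne hf.2.ne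
  obtain hN | hN := eq_or_ne N 0
  · have hg₀ : g =ᵐ[μ] 0 :=
      (eLpNorm_eq_zero_iff hg.aestronglyMeasurable (by simpa using hp₀)).1 hN
    simp [rieszPotential_congr_ae hg₀, rieszPotential, eLpNorm_ofReal hq, hq, hN]
  have normalized : ∫⁻ y, (N⁻¹ * g y) ^ p ∂μ ≤ 1 := by
    have hNp : N ^ p = ∫⁻ y, g y ^ p ∂μ := by
      rw [hN_def, eLpNorm_ofReal hp₀, ENNReal.rpow_inv_rpow hp₀.ne']
      rfl
    simp_rw [ENNReal.mul_rpow_of_nonneg _ _ hp₀.le]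
    rw [lintegral_const_mul _ (by fun_prop), ← hNp, ← ENNReal.mul_rpow_of_nonneg _ _ hp₀.le,
      ENNReal.inv_mul_cancel hN hN_top, ENNReal.one_rpow]
  rw [mul_comm, ← ENNReal.inv_mul_le_iff hN hN_top]
  calc N⁻¹ * eLpNorm (rieszPotential μ β g) (ENNReal.ofReal q) μ
      = (∫⁻ x, rieszPotential μ β (fun y => N⁻¹ * g y) x ^ q ∂μ) ^ q⁻¹ := by
        simp_rw [rieszPotential_const_mul hg, ENNReal.mul_rpow_of_nonneg _ _ hq.le]
        rw [lintegral_const_mul _ ((measurable_rieszPotential hg.aemeasurable β).pow_const q),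
          ENNReal.mul_rpow_of_nonneg _ _ (inv_nonneg.2 hq.le), ENNReal.rpow_rpow_inv hq.ne',
          eLpNorm_ofReal hq]
        rfl
    _ ≤ ((C : ℝ≥0∞) ^ q) ^ q⁻¹ := by gcongr; exact hC _ (by fun_prop) normalized
    _ = C := ENNReal.rpow_rpow_inv hq.ne' _

theorem exists_eLpNorm_setIntegral_kernel_smul_le [SecondCountableTopology X] [SigmaFinite μ]
    {A : ℝ≥0} {ν β p q : ℝ} (hμ : IsUpperRegular μ A ν) (hβ : 0 < β) (hβν : β < ν) (hp : 1 < p)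
    (hq : 0 < q) (hpq : q⁻¹ = p⁻¹ + β / ν - 1) (E : Type*) [NormedAddCommGroup E]
    [NormedSpace ℝ E] :
    ∃ C : ℝ≥0, ∀ (k : X → X → ℝ) (s : X → Set X), Measurable (Function.uncurry k) →
      MeasurableSet {z : X × X | z.2 ∈ s z.1} → (∀ x, ∀ y ∈ s x, |k x y| ≤ dist x y ^ (-β)) →
      ∀ φ : X → E, MemLp φ (ENNReal.ofReal p) μ →
        (∀ᵐ x ∂μ, IntegrableOn (fun y => k x y • φ y) (s x) μ) ∧
        MemLp (fun x => ∫ y in s x, k x y • φ y ∂μ) (ENNReal.ofReal q) μ ∧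
        eLpNorm (fun x => ∫ y in s x, k x y • φ y ∂μ) (ENNReal.ofReal q) μ ≤
          C * eLpNorm φ (ENNReal.ofReal p) μ := by
  obtain ⟨C, hC⟩ := exists_eLpNorm_rieszPotential_le hμ hβ hβν hp hq hpq
  refine ⟨C, fun k s hk hs hks φ hφ => ?_⟩
  have hsx (x : X) : MeasurableSet (s x) := measurable_prodMk_left hs
  set I := rieszPotential μ β (‖φ ·‖ₑ)
  have dominated (x : X) : ∫⁻ y in s x, ‖k x y • φ y‖ₑ ∂μ ≤ I x := by
    refine (setLIntegral_mono_ae' (hsx x) (.of_forall fun y hy => ?_)).trans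
      (setLIntegral_le_lintegral _ _)
    rw [enorm_smul, Real.enorm_eq_ofReal_abs]
    gcongr
    exact hks x y hy
  have norm_I_le : eLpNorm I (ENNReal.ofReal q) μ ≤ C * eLpNorm φ (ENNReal.ofReal p) μ :=
    (hC _ hφ.enorm).trans_eq (by rw [eLpNorm_enorm])
  have norm_I_lt_top : eLpNorm I (ENNReal.ofReal q) μ < ∞ :=
    norm_I_le.trans_lt (ENNReal.mul_lt_top ENNReal.coe_lt_top hφ.2)
  have I_lt_top : ∀ᵐ x ∂μ, I x < ∞ := by
    rw [eLpNorm_ofReal hq, ENNReal.rpow_lt_top_iff_of_pos (inv_pos.2 hq)] at norm_I_lt_top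
    have hIm : Measurable I := measurable_rieszPotential hφ.1.enorm β
    exact (ae_lt_top (by fun_prop) norm_I_lt_top.ne).mono
      fun x hx => (ENNReal.rpow_lt_top_iff_of_pos hq).1 hx
  have norm_le : eLpNorm (fun x => ∫ y in s x, k x y • φ y ∂μ) (ENNReal.ofReal q) μ ≤
      eLpNorm I (ENNReal.ofReal q) μ :=
    eLpNorm_mono_enorm fun x => (enorm_integral_le_lintegral_enorm _).trans (dominated x)
  have integral_measurable : AEStronglyMeasurable (fun x => ∫ y in s x, k x y • φ y ∂μ) μ := by
    simp_rw [fun x => (integral_indicator (hsx x) (f := fun y => k x y • φ y) (μ := μ)).symm]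
    have kernel_measurable : AEStronglyMeasurable (fun z : X × X => k z.1 z.2 • φ z.2) (μ.prod μ) :=
      hk.aestronglyMeasurable.smul hφ.1.comp_snd
    exact (kernel_measurable.indicator hs).integral_prod_right'
  exact ⟨I_lt_top.mono fun x hx => ⟨hk.of_uncurry_left.aestronglyMeasurable.smul hφ.1.restrict,
    (dominated x).trans_lt hx⟩, ⟨integral_measurable, norm_le.trans_lt norm_I_lt_top⟩,
    norm_le.trans norm_I_le⟩

end RieszPotential

section ToSphere

open Metric Set
open scoped Pointwise

variable {E : Type*} [NormedAddCommGroup E] [NormedSpace ℝ E]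

theorem Ioo_smul_ball_subset (x : sphere (0 : E) 1) (r : ℝ) :
    Ioo (0 : ℝ) 1 • ((↑) '' ball x r : Set E) ⊆
      (1 - r) • (Ioo (0 : ℝ) 1 • ((↑) '' ball x r : Set E)) ∪ closedBall (x : E) (2 * r) := by
  rintro _ ⟨t, ⟨ht₀, ht₁⟩, _, ⟨y, hy, rfl⟩, rfl⟩
  rcases lt_or_ge t (1 - r) with ht | ht
  · have hr : 0 < 1 - r := ht₀.trans ht
    refine Or.inl (mem_smul_set.2 ⟨(t / (1 - r)) • y, smul_mem_smul
      ⟨by positivity, (div_lt_one hr).2 ht⟩ (mem_image_of_mem _ hy), ?_⟩)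
    rw [smul_smul, mul_div_cancel₀ _ hr.ne']
  · refine Or.inr (mem_closedBall.2 ?_)
    calc dist (t • (y : E)) x ≤ dist (t • (y : E)) ((1 : ℝ) • (y : E)) + dist (y : E) x := by
          simpa using dist_triangle (t • (y : E)) y x
      _ ≤ r + r := by
          gcongr
          · rw [dist_eq_norm, ← sub_smul, norm_smul, norm_eq_of_mem_sphere y, mul_one,
              Real.norm_eq_abs, abs_of_neg (by linarith)]
            linarith
          · exact (mem_ball.1 hy).le
      _ = 2 * r := (two_mul r).symm

variable [MeasurableSpace E] [BorelSpace E] [FiniteDimensional ℝ E] (μ : Measure E)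
  [μ.IsAddHaarMeasure]

theorem measureReal_Ioo_smul_ball_le (x : sphere (0 : E) 1) {r : ℝ} (hr₀ : 0 < r) (hr₁ : r ≤ 1) :
    μ.real (Ioo (0 : ℝ) 1 • ((↑) '' ball x r : Set E)) ≤
      2 ^ Module.finrank ℝ E * r ^ ((Module.finrank ℝ E : ℝ) - 1) * μ.real (ball (0 : E) 1) := by
  set d := Module.finrank ℝ E
  set V := Ioo (0 : ℝ) 1 • ((↑) '' ball x r : Set E)
  have hd : d ≠ 0 := by
    have : Nontrivial E := ⟨x, 0, ne_zero_of_mem_unit_sphere x⟩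
    exact Module.finrank_pos.ne'
  have hV : μ V ≠ ∞ := by
    refine ((measure_mono ?_).trans_lt (measure_ball_lt_top (x := (0 : E)) (r := 1))).ne
    rintro _ ⟨t, ht, _, ⟨y, -, rfl⟩, rfl⟩
    simpa [norm_smul, abs_of_pos ht.1] using ht.2
  have scaled_le : μ.real ((1 - r) • V) ≤ (1 - r) * μ.real V := by
    rw [measureReal_def, Measure.addHaar_smul_of_nonneg _ (by linarith), ENNReal.toReal_mul,
      ENNReal.toReal_ofReal (by bound), ← measureReal_def]
    gcongr
    exact pow_le_of_le_one (by linarith) (by linarith) hd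
  have subdivision : μ.real V ≤ (1 - r) * μ.real V + (2 * r) ^ d * μ.real (ball (0 : E) 1) :=
    calc μ.real V ≤ μ.real ((1 - r) • V ∪ closedBall (x : E) (2 * r)) :=
          measureReal_mono (Ioo_smul_ball_subset x r) (measure_union_lt_top
            (by rw [Measure.addHaar_smul]; exact ENNReal.mul_lt_top ENNReal.ofReal_lt_top hV.lt_top)
            measure_closedBall_lt_top).ne
      _ ≤ μ.real ((1 - r) • V) + μ.real (closedBall (x : E) (2 * r)) := measureReal_union_le _ _
      _ ≤ (1 - r) * μ.real V + (2 * r) ^ d * μ.real (ball (0 : E) 1) := by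
          rw [Measure.addHaar_real_closedBall μ _ (by positivity)]
          gcongr
  have pow_eq : (2 * r) ^ d = 2 ^ d * r ^ ((d : ℝ) - 1) * r := by
    rw [Real.rpow_sub_one hr₀.ne', Real.rpow_natCast, mul_assoc, div_mul_cancel₀ _ hr₀.ne',
      mul_pow]
  refine le_of_mul_le_mul_right ?_ hr₀
  rw [pow_eq] at subdivision
  linarith

theorem toSphere_real_ball_le (x : sphere (0 : E) 1) {r : ℝ} (hr₀ : 0 < r) :
    μ.toSphere.real (ball x r) ≤
      2 ^ Module.finrank ℝ E * μ.toSphere.real univ * r ^ ((Module.finrank ℝ E : ℝ) - 1) := by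
  rcases le_total r 1 with hr₁ | hr₁
  · rw [measureReal_def, μ.toSphere_apply' measurableSet_ball, ENNReal.toReal_mul,
      ENNReal.toReal_natCast, ← measureReal_def, μ.toSphere_real_apply_univ]
    calc _ ≤ (Module.finrank ℝ E : ℝ) * (2 ^ Module.finrank ℝ E *
            r ^ ((Module.finrank ℝ E : ℝ) - 1) * μ.real (ball (0 : E) 1)) := by
          gcongr
          exact measureReal_Ioo_smul_ball_le μ x hr₀ hr₁
      _ = _ := by ring
  · have : Nontrivial E := ⟨x, 0, ne_zero_of_mem_unit_sphere x⟩
    have one_le_finrank : (1 : ℝ) ≤ Module.finrank ℝ E :=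
      Nat.one_le_cast.2 Module.finrank_pos
    calc μ.toSphere.real (ball x r) ≤ 1 * μ.toSphere.real univ * 1 := by
          rw [one_mul, mul_one]
          exact measureReal_mono (subset_univ _)
      _ ≤ _ := by
          gcongr
          · exact one_le_pow₀ one_le_two
          · exact Real.one_le_rpow hr₁ (by linarith)

theorem isUpperRegular_toSphere :
    IsUpperRegular μ.toSphere (2 ^ Module.finrank ℝ E * (μ.toSphere univ).toNNReal)
      (Module.finrank ℝ E - 1) := by
  intro x r hr₀
  rw [← ofReal_measureReal (measure_ne_top _ _), ← ENNReal.ofReal_coe_nnreal,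
    ← ENNReal.ofReal_mul NNReal.zero_le_coe]
  refine ENNReal.ofReal_le_ofReal ?_
  simpa [measureReal_def, ENNReal.coe_toNNReal_eq_toReal] using toSphere_real_ball_le μ x hr₀

end ToSphere

section Sphere

variable {n : ℕ}

instance : IsFiniteMeasure (surfaceMeasure n) :=
  inferInstanceAs (IsFiniteMeasure (Measure.toSphere _))

theorem exists_isUpperRegular_surfaceMeasure (n : ℕ) :
    ∃ A, IsUpperRegular (surfaceMeasure n) A n :=
  ⟨_, by simpa [surfaceMeasure] using
    isUpperRegular_toSphere (volume : Measure (EuclideanSpace ℝ (Fin (n + 1))))⟩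

@[fun_prop]
theorem measurable_lastCoord : Measurable (lastCoord : Sph n → ℝ) := by
  unfold lastCoord
  fun_prop

theorem abs_lastCoord_sub_le (x y : Sph n) : |lastCoord x - lastCoord y| ≤ dist x y :=
  (PiLp.norm_apply_le (x - y : EuclideanSpace ℝ (Fin (n + 1))) (Fin.last n)).trans_eq
    (dist_eq_norm _ _).symm

theorem abs_rpow_div_pow_le {α s d : ℝ} (hα : 0 ≤ α) (hs : 0 < s) (hsd : s ≤ d) (n : ℕ) :
    |s ^ α / d ^ n| ≤ d ^ (-(n - α)) := by
  have hd : 0 < d := hs.trans_le hsd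
  rw [abs_of_nonneg (by positivity), neg_sub, Real.rpow_sub hd, Real.rpow_natCast]
  gcongr

theorem exists_eLpNorm_smul_setIntegral_rpow_div_pow_smul_le {α p : ℝ} (hα : 0 < α) (hp : 1 < p)
    (hpn : p < (n : ℝ) / α) (c : ℝ) (E : Type*) [NormedAddCommGroup E] [NormedSpace ℝ E] :
    ∃ C : ℝ≥0, ∀ (h : Sph n → Sph n → ℝ) (s : Sph n → Set (Sph n)),
      Measurable (Function.uncurry h) → MeasurableSet {z : Sph n × Sph n | z.2 ∈ s z.1} →
      (∀ x, ∀ y ∈ s x, 0 < h x y ∧ h x y ≤ dist x y) →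
      ∀ φ : Sph n → E, MemLp φ (ENNReal.ofReal p) (surfaceMeasure n) →
        let T : Sph n → E := fun x =>
          c • ∫ y in s x, (h x y ^ α / dist x y ^ n) • φ y ∂(surfaceMeasure n)
        (∀ᵐ x ∂(surfaceMeasure n),
          IntegrableOn (fun y => (h x y ^ α / dist x y ^ n) • φ y) (s x) (surfaceMeasure n)) ∧
        MemLp T (ENNReal.ofReal (n * p / (n - α * p))) (surfaceMeasure n) ∧
        eLpNorm T (ENNReal.ofReal (n * p / (n - α * p))) (surfaceMeasure n) ≤
          C * eLpNorm φ (ENNReal.ofReal p) (surfaceMeasure n) := by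
  have hpα : 0 < n - α * p := by
    linarith [(lt_div_iff₀' hα).1 hpn]
  have hαn : 0 < n - α := by nlinarith
  have hn : (0 : ℝ) < n := by linarith
  have hq : 0 < n * p / (n - α * p) := by positivity
  obtain ⟨A, hA⟩ := exists_isUpperRegular_surfaceMeasure n
  obtain ⟨M, hM⟩ := exists_eLpNorm_setIntegral_kernel_smul_le hA hαn (by linarith) hp hq
    (by field_simp; ring) E
  refine ⟨‖c‖₊ * M, fun h s hh hs hsd φ hφ => ?_⟩
  obtain ⟨integrable, memLp, norm_le⟩ := hM (fun x y => h x y ^ α / dist x y ^ n) s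
    ((hh.pow_const α).div (by fun_prop)) hs
    (fun x y hy => abs_rpow_div_pow_le hα.le (hsd x y hy).1 (hsd x y hy).2 n) φ hφ
  refine ⟨integrable, memLp.const_smul c, (eLpNorm_const_smul c _ _ _).trans_le ?_⟩
  rw [ENNReal.coe_mul, mul_assoc]
  exact mul_le_mul_right norm_le _

end Sphere

end SphFrac

open SphFrac in
theorem mainTheorem6_general {𝕜 : Type*} [RCLike 𝕜] (n : ℕ) (α p : ℝ) (hα : 0 < α)
    (hp : 1 < p) (hpn : p < (n : ℝ) / α) :
    ∃ C : ℝ≥0, ∀ (a b : ℝ) (φ : Sph n → 𝕜), MemLp φ (ENNReal.ofReal p) (surfaceMeasure n) →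
      ((∀ᵐ x ∂(surfaceMeasure n),
          IntegrableOn (leftIntegrand α φ x) (segment n a (lastCoord x)) (surfaceMeasure n)) ∧
        MemLp (leftInt α a φ) (ENNReal.ofReal (n * p / (n - α * p))) (surfaceMeasure n) ∧
        eLpNorm (leftInt α a φ) (ENNReal.ofReal (n * p / (n - α * p))) (surfaceMeasure n) ≤
          C * eLpNorm φ (ENNReal.ofReal p) (surfaceMeasure n)) ∧
      ((∀ᵐ x ∂(surfaceMeasure n),
          IntegrableOn (rightIntegrand α φ x) (segment n (lastCoord x) b) (surfaceMeasure n)) ∧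
        MemLp (rightInt α b φ) (ENNReal.ofReal (n * p / (n - α * p))) (surfaceMeasure n) ∧
        eLpNorm (rightInt α b φ) (ENNReal.ofReal (n * p / (n - α * p))) (surfaceMeasure n) ≤
          C * eLpNorm φ (ENNReal.ofReal p) (surfaceMeasure n)) := by
  obtain ⟨C, hC⟩ := exists_eLpNorm_smul_setIntegral_rpow_div_pow_smul_le hα hp hpn
    (2 / (Real.Gamma α * sigma n)) 𝕜
  refine ⟨C, fun a b φ hφ => ⟨?_, ?_⟩⟩
  · exact hC (fun x y => lastCoord x - lastCoord y) (fun x => SphFrac.segment n a (lastCoord x))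
      (by unfold Function.uncurry; fun_prop) (by unfold SphFrac.segment; measurability)
      (fun x y hy => ⟨sub_pos.2 hy.2, (le_abs_self _).trans (abs_lastCoord_sub_le x y)⟩) φ hφ
  · exact hC (fun x y => lastCoord y - lastCoord x) (fun x => SphFrac.segment n (lastCoord x) b)
      (by unfold Function.uncurry; fun_prop) (by unfold SphFrac.segment; measurability)
      (fun x y hy => ⟨sub_pos.2 hy.1,
        (le_abs_self _).trans (dist_comm x y ▸ abs_lastCoord_sub_le y x)⟩) φ hφ

theorem mainTheorem6 {𝕜 : Type*} [RCLike 𝕜] (n : ℕ) (hn : 2 ≤ n) (α p : ℝ) (hα : 0 < α)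
    (hp : 1 < p) (hpn : p < (n : ℝ) / α) :
    ∃ C : ℝ≥0, ∀ φ : SphFrac.Sph n → 𝕜,
      MemLp φ (ENNReal.ofReal p) (SphFrac.surfaceMeasure n) →
      ((∀ᵐ x ∂(SphFrac.surfaceMeasure n),
          IntegrableOn (SphFrac.leftIntegrand α φ x)
            (SphFrac.segment n (-1) (SphFrac.lastCoord x)) (SphFrac.surfaceMeasure n)) ∧
        MemLp (SphFrac.Splus α φ) (ENNReal.ofReal (n * p / (n - α * p)))
          (SphFrac.surfaceMeasure n) ∧
        eLpNorm (SphFrac.Splus α φ) (ENNReal.ofReal (n * p / (n - α * p)))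
            (SphFrac.surfaceMeasure n) ≤
          C * eLpNorm φ (ENNReal.ofReal p) (SphFrac.surfaceMeasure n)) ∧
      ((∀ᵐ x ∂(SphFrac.surfaceMeasure n),
          IntegrableOn (SphFrac.rightIntegrand α φ x)
            (SphFrac.segment n (SphFrac.lastCoord x) 1) (SphFrac.surfaceMeasure n)) ∧
        MemLp (SphFrac.Sminus α φ) (ENNReal.ofReal (n * p / (n - α * p)))
          (SphFrac.surfaceMeasure n) ∧
        eLpNorm (SphFrac.Sminus α φ) (ENNReal.ofReal (n * p / (n - α * p)))
            (SphFrac.surfaceMeasure n) ≤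
          C * eLpNorm φ (ENNReal.ofReal p) (SphFrac.surfaceMeasure n)) := by
  obtain ⟨C, hC⟩ := mainTheorem6_general (𝕜 := 𝕜) n α p hα hp hpn
  exact ⟨C, hC (-1) 1⟩
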